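/- Let $n\ge 2$, let $\mathbb S^{n-1}$ be the unit sphere of $\mathbb R^n$, and let $\tau\ge 0$ be an integer. A weighted spherical code $(C,W)$ on $\mathbb S^{n-1}$ consists of distinct points $C=(x_1,\dots,x_N)$ of $\mathbb S^{n-1}$ and weights $W=(w_1,\dots,w_N)$ with $w_i>0$ and $w_1+\dots+w_N=1$. Let $P_\ell^{(n)}$, $\ell=0,1,2,\dots$, be the Gegenbauer polynomials: $P_\ell^{(n)}$ has degree $\ell$, the polynomials are mutually orthogonal with respect to the probability measure $d\mu_n(t)=\gamma_n(1-t^2)^{(n-3)/2}\,dt$ on $[-1,1]$, where $\gamma_n=\Gamma(n/2)/\bigl(\sqrt{\pi}\,\Gamma((n-1)/2)\bigr)$, and $P_\ell^{(n)}(1)=1$. The code $(C,W)$ is called a weighted spherical $\tau$-design if $$M_\ell(C,W):=\sum_{i,j=1}^N w_iw_jP_\ell^{(n)}(x_i\cdot x_j)=0\qquad\text{for all } 1\le \ell\le\tau .$$ For a real polynomial $f$ let $f_0$ be the coefficient of $P_0^{(n)}$ in its Gegenbauer expansion $f=\sum_{\ell} f_\ell P_\ell^{(n)}$. **Theorem.**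 A weighted spherical code $(C,W)$ on $\mathbb S^{n-1}$ is a weighted spherical $\tau$-design if and only if, for every point $x\in\mathbb S^{n-1}$ and every real polynomial $f$ of degree at most $\tau$, $$\sum_{j=1}^N w_j f(x\cdot x_j)=f_0 .$$ -/

import Mathlib

open Polynomial

noncomputable section

namespace WeightedDesign

/-- The normalizing constant `γ_n = Γ(n/2) / (√π Γ((n-1)/2))`. -/
def gammaConst (n : ℕ) : ℝ :=
  Real.Gamma ((n : ℝ) / 2) / (Real.sqrt Real.pi * Real.Gamma (((n : ℝ) - 1) / 2))

/-- The density `γ_n (1 - t²)^((n-3)/2)` of the measure `μ_n` on `[-1, 1]`. -/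
def weight (n : ℕ) (t : ℝ) : ℝ :=
  gammaConst n * (1 - t ^ 2) ^ (((n : ℝ) - 3) / 2)

/-- The pairing `∫ p q dμ_n` of two real polynomials. -/
def ip (n : ℕ) (p q : ℝ[X]) : ℝ :=
  ∫ t in (-1 : ℝ)..1, p.eval t * q.eval t * weight n t

/-- `p` is the Gegenbauer polynomial of degree `i` for dimension `n`: it has degree `i`, is
orthogonal with respect to `μ_n` to all polynomials of smaller degree, and `p(1) = 1`. -/
structure IsGegenbauer (n i : ℕ) (p : ℝ[X]) : Prop where
  degree_eq : p.degree = (i : WithBot ℕ)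
  orthogonal : ∀ q : ℝ[X], q.degree < (i : WithBot ℕ) → ip n p q = 0
  eval_one : p.eval 1 = 1

theorem gammaConst_pos {n : ℕ} (hn : 2 ≤ n) : 0 < gammaConst n := by
  have h2 : (2 : ℝ) ≤ n := by exact_mod_cast hn
  unfold gammaConst
  have h1 := Real.Gamma_pos_of_pos (s := (n : ℝ) / 2) (by linarith)
  have h3 := Real.Gamma_pos_of_pos (s := ((n : ℝ) - 1) / 2) (by linarith)
  have := Real.pi_pos
  positivity

theorem weight_pos {n : ℕ} (hn : 2 ≤ n) {t : ℝ} (ht : t ∈ Set.Ioo (-1 : ℝ) 1) :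
    0 < weight n t := by
  have h : 0 < 1 - t ^ 2 := by nlinarith [ht.1, ht.2]
  exact mul_pos (gammaConst_pos hn) (Real.rpow_pos_of_pos h _)

theorem intervalIntegrable_weight {n : ℕ} (hn : 2 ≤ n) :
    IntervalIntegrable (weight n) MeasureTheory.volume (-1) 1 := by
  have h2 : (2 : ℝ) ≤ n := by exact_mod_cast hn
  have hbase : IntervalIntegrable (fun t : ℝ => 1 / Real.sqrt (1 - t ^ 2))
      MeasureTheory.volume (-1) 1 := by
    apply intervalIntegral.intervalIntegrable_deriv_of_nonneg (g := Real.arcsin)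
    · exact Real.continuous_arcsin.continuousOn
    · intro x hx
      have hx' : x ∈ Set.Ioo (-1 : ℝ) 1 := by simpa using hx
      exact Real.hasDerivAt_arcsin hx'.1.ne' hx'.2.ne
    · intro x _
      positivity
  refine IntervalIntegrable.const_mul ?_ (gammaConst n)
  rw [intervalIntegrable_iff_integrableOn_Ioo_of_le (by norm_num)] at hbase ⊢
  refine MeasureTheory.Integrable.mono' hbase ?_ ?_
  · exact (Measurable.pow_const (by fun_prop) _).aestronglyMeasurable
  · refine (MeasureTheory.ae_restrict_iff' measurableSet_Ioo).2 (Filter.Eventually.of_forall ?_)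
    intro t ht
    have h0 : 0 < 1 - t ^ 2 := by nlinarith [ht.1, ht.2]
    have h1 : 1 - t ^ 2 ≤ 1 := by nlinarith [sq_nonneg t]
    rw [Real.norm_of_nonneg (Real.rpow_nonneg h0.le _), Real.sqrt_eq_rpow, one_div,
      ← Real.rpow_neg h0.le]
    exact Real.rpow_le_rpow_of_exponent_ge h0 h1 (by linarith)

theorem intervalIntegrable_ip {n : ℕ} (hn : 2 ≤ n) (p q : ℝ[X]) :
    IntervalIntegrable (fun t => p.eval t * q.eval t * weight n t)
      MeasureTheory.volume (-1) 1 :=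
  (intervalIntegrable_weight hn).continuousOn_mul
    (p.continuous.mul q.continuous).continuousOn

/-- The pairing `ip` as a bilinear form. -/
def ipForm (n : ℕ) (hn : 2 ≤ n) : ℝ[X] →ₗ[ℝ] ℝ[X] →ₗ[ℝ] ℝ :=
  LinearMap.mk₂ ℝ (ip n)
    (fun p p' q => by
      unfold ip
      rw [← intervalIntegral.integral_add (intervalIntegrable_ip hn _ _)
        (intervalIntegrable_ip hn _ _)]
      exact intervalIntegral.integral_congr fun t _ => by simp only [eval_add]; ring)
    (fun c p q => by
      unfold ip
      rw [smul_eq_mul, ← intervalIntegral.integral_const_mul]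
      exact intervalIntegral.integral_congr fun t _ => by
        simp only [eval_smul, smul_eq_mul]; ring)
    (fun p q q' => by
      unfold ip
      rw [← intervalIntegral.integral_add (intervalIntegrable_ip hn _ _)
        (intervalIntegrable_ip hn _ _)]
      exact intervalIntegral.integral_congr fun t _ => by simp only [eval_add]; ring)
    (fun c p q => by
      unfold ip
      rw [smul_eq_mul, ← intervalIntegral.integral_const_mul]
      exact intervalIntegral.integral_congr fun t _ => by
        simp only [eval_smul, smul_eq_mul]; ring)

@[simp] theorem ipForm_apply (n : ℕ) (hn : 2 ≤ n) (p q : ℝ[X]) :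
    ipForm n hn p q = ip n p q := rfl

/-- A nonzero polynomial that is nonnegative on `(-1, 1)` has positive integral against `μ_n`. -/
theorem ip_pos {n : ℕ} (hn : 2 ≤ n) {p q r : ℝ[X]} (hpq : p * q = r) (hr : r ≠ 0)
    (hnn : ∀ t ∈ Set.Ioo (-1 : ℝ) 1, 0 ≤ r.eval t) : 0 < ip n p q := by
  have hint := intervalIntegrable_ip hn p q
  have hev : ∀ t, p.eval t * q.eval t = r.eval t := fun t => by rw [← hpq, eval_mul]
  unfold ip
  rw [intervalIntegral.integral_pos_iff_support_of_nonneg_ae' _ hint]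
  · refine ⟨by norm_num, ?_⟩
    have hfin : ({t | r.IsRoot t} : Set ℝ).Finite := Polynomial.finite_setOfPred_isRoot hr
    have hsub : Set.Ioo (-1 : ℝ) 1 \ {t | r.IsRoot t} ⊆
        Function.support (fun t => p.eval t * q.eval t * weight n t) ∩ Set.Ioc (-1) 1 := by
      intro t ht
      refine ⟨?_, Set.Ioo_subset_Ioc_self ht.1⟩
      rw [Function.mem_support, hev]
      exact mul_ne_zero ht.2 (weight_pos hn ht.1).ne'
    refine lt_of_lt_of_le ?_ (MeasureTheory.measure_mono hsub)
    rw [MeasureTheory.measure_sdiff_null (hfin.measure_zero _)]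
    simp
  · rw [Set.uIoc_of_le (by norm_num), ← MeasureTheory.restrict_Ioo_eq_restrict_Ioc]
    refine (MeasureTheory.ae_restrict_iff' measurableSet_Ioo).2 (Filter.Eventually.of_forall ?_)
    intro t ht
    simp only [Pi.zero_apply, hev]
    exact mul_nonneg (hnn t ht) (weight_pos hn ht).le

theorem ip_self_pos {n : ℕ} (hn : 2 ≤ n) {p : ℝ[X]} (hp : p ≠ 0) : 0 < ip n p p :=
  ip_pos hn rfl (mul_ne_zero hp hp) fun t _ => by
    rw [eval_mul]; exact mul_self_nonneg _

theorem exists_isGegenbauer {n : ℕ} (hn : 2 ≤ n) (i : ℕ) : ∃ p, IsGegenbauer n i p := by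
  -- project `X ^ i` onto the polynomials of smaller degree
  let V := degreeLT ℝ i
  have : FiniteDimensional ℝ V := (degreeLTEquiv ℝ i).symm.finiteDimensional
  let B : V →ₗ[ℝ] Module.Dual ℝ V := ((ipForm n hn).domRestrict V).compl₂ V.subtype
  have hB : ∀ u v : V, B u v = ip n (u : ℝ[X]) (v : ℝ[X]) := fun u v => rfl
  have hinj : Function.Injective B := by
    rw [← LinearMap.ker_eq_bot, LinearMap.ker_eq_bot']
    intro u hu
    by_contra hne
    have h := ip_self_pos hn (p := (u : ℝ[X])) (fun h => hne (Subtype.ext h))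
    rw [← hB, hu] at h
    simp at h
  have hsurj : Function.Surjective B :=
    (LinearMap.injective_iff_surjective_of_finrank_eq_finrank
      Subspace.dual_finrank_eq.symm).1 hinj
  obtain ⟨r, hr⟩ := hsurj ((ipForm n hn (X ^ i)).comp V.subtype)
  have hrdeg : (r : ℝ[X]).degree < (i : WithBot ℕ) := mem_degreeLT.1 r.2
  set G : ℝ[X] := X ^ i - (r : ℝ[X]) with hG
  have hGdeg : G.degree = (i : WithBot ℕ) := by
    rw [hG, degree_sub_eq_left_of_degree_lt (by rwa [degree_X_pow]), degree_X_pow]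
  have horth : ∀ q : ℝ[X], q.degree < (i : WithBot ℕ) → ip n G q = 0 := by
    intro q hq
    have h := LinearMap.congr_fun hr (⟨q, mem_degreeLT.2 hq⟩ : V)
    rw [hB] at h
    have h' : ip n (r : ℝ[X]) q = ip n (X ^ i) q := h
    rw [← ipForm_apply n hn, hG, map_sub, LinearMap.sub_apply, ipForm_apply, ipForm_apply, h',
      sub_self]
  have hG0 : G ≠ 0 := by
    intro h
    rw [h, degree_zero] at hGdeg
    exact absurd hGdeg.symm (WithBot.coe_ne_bot)
  have hG1 : G.eval 1 ≠ 0 := by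
    intro h
    obtain ⟨q, hq⟩ := dvd_iff_isRoot.2 h
    have hq0 : q ≠ 0 := fun h0 => hG0 (by rw [hq, h0, mul_zero])
    have hqdeg : q.degree < (i : WithBot ℕ) := by
      rw [← hGdeg, hq, degree_mul, degree_X_sub_C, degree_eq_natDegree hq0]
      exact_mod_cast (by omega : q.natDegree < 1 + q.natDegree)
    have hpos : 0 < ip n G (-q) := by
      refine ip_pos hn (r := (1 - X) * (q * q)) ?_ ?_ ?_
      · rw [hq, map_one]; ring
      · refine mul_ne_zero ?_ (mul_ne_zero hq0 hq0)
        intro h1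
        have := congrArg (eval 0) h1
        simp at this
      · intro t ht
        simp only [eval_mul, eval_sub, eval_one, eval_X]
        exact mul_nonneg (by linarith [ht.2]) (mul_self_nonneg _)
    rw [horth (-q) (by rwa [degree_neg])] at hpos
    exact lt_irrefl _ hpos
  refine ⟨C (G.eval 1)⁻¹ * G, ?_, ?_, ?_⟩
  · rw [degree_C_mul (inv_ne_zero hG1), hGdeg]
  · intro q hq
    rw [← ipForm_apply n hn, ← smul_eq_C_mul, map_smul, LinearMap.smul_apply, ipForm_apply,
      horth q hq, smul_zero]
  · rw [eval_mul, eval_C, inv_mul_cancel₀ hG1]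

theorem IsGegenbauer.unique {n i : ℕ} (hn : 2 ≤ n) {p p' : ℝ[X]} (hp : IsGegenbauer n i p)
    (hp' : IsGegenbauer n i p') : p = p' := by
  have ha : p.leadingCoeff ≠ 0 := leadingCoeff_ne_zero.2 (by
    intro h; have := hp.degree_eq; rw [h, degree_zero] at this
    exact absurd this.symm WithBot.coe_ne_bot)
  have hb : p'.leadingCoeff ≠ 0 := leadingCoeff_ne_zero.2 (by
    intro h; have := hp'.degree_eq; rw [h, degree_zero] at this
    exact absurd this.symm WithBot.coe_ne_bot)
  set d : ℝ[X] := C p'.leadingCoeff * p - C p.leadingCoeff * p' with hd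
  have hdeg : d.degree < (i : WithBot ℕ) := by
    rw [← hp.degree_eq, ← degree_C_mul (p := p) hb, hd]
    apply degree_sub_lt_left
    · rw [degree_C_mul hb, degree_C_mul ha, hp.degree_eq, hp'.degree_eq]
    · exact mul_ne_zero (C_ne_zero.2 hb) (leadingCoeff_ne_zero.1 ha)
    · simp [mul_comm]
  have h0 : ip n d d = 0 := by
    have e : ipForm n hn d d = 0 := by
      have hd' : d = p'.leadingCoeff • p - p.leadingCoeff • p' := by
        rw [hd, smul_eq_C_mul, smul_eq_C_mul]
      have e' : ipForm n hn d = p'.leadingCoeff • ipForm n hn p -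
          p.leadingCoeff • ipForm n hn p' := by
        rw [← map_smul, ← map_smul, ← map_sub, ← hd']
      rw [e', LinearMap.sub_apply,
        LinearMap.smul_apply, LinearMap.smul_apply, ipForm_apply, ipForm_apply,
        hp.orthogonal d hdeg, hp'.orthogonal d hdeg]
      simp
    exact e
  have hd0 : d = 0 := by
    by_contra h
    exact (ip_self_pos hn h).ne' h0
  have hab : p'.leadingCoeff = p.leadingCoeff := by
    have := congrArg (eval 1) hd0
    simp only [hd, eval_sub, eval_mul, eval_C, hp.eval_one, hp'.eval_one, eval_zero] at this
    linarith
  rw [hd, hab, ← mul_sub] at hd0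
  exact sub_eq_zero.1 ((mul_eq_zero.1 hd0).resolve_left (C_ne_zero.2 ha))

/-- The Gegenbauer polynomial `P_i^{(n)}`, for `n ≥ 2`, normalized by `P_i^{(n)}(1) = 1`. It exists
and is unique by `exists_isGegenbauer` and `IsGegenbauer.unique`. -/
def gegenbauer (n : ℕ) (hn : 2 ≤ n) (i : ℕ) : ℝ[X] :=
  Classical.choose (exists_isGegenbauer hn i)

theorem gegenbauer_spec (n : ℕ) (hn : 2 ≤ n) (i : ℕ) :
    IsGegenbauer n i (gegenbauer n hn i) :=
  Classical.choose_spec (exists_isGegenbauer hn i)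

/-- The Gegenbauer polynomials as a sequence with one polynomial in each degree. -/
def gegenbauerSequence (n : ℕ) (hn : 2 ≤ n) : Polynomial.Sequence ℝ where
  elems' := gegenbauer n hn
  degree_eq' i := (gegenbauer_spec n hn i).degree_eq

/-- The basis of `ℝ[X]` consisting of the Gegenbauer polynomials. -/
def gegenbauerBasis (n : ℕ) (hn : 2 ≤ n) : Module.Basis ℕ ℝ ℝ[X] :=
  (gegenbauerSequence n hn).basis fun i =>
    isUnit_iff_ne_zero.2 (leadingCoeff_ne_zero.2 ((gegenbauerSequence n hn).ne_zero i))

/-- The coefficient `f_ℓ` in the Gegenbauer expansion `f = ∑ f_ℓ P_ℓ^{(n)}`. -/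
def gegenbauerCoeff (n : ℕ) (hn : 2 ≤ n) (f : ℝ[X]) (ℓ : ℕ) : ℝ :=
  (gegenbauerBasis n hn).repr f ℓ

/-- A weighted spherical code of size `N` on the unit sphere of `ℝⁿ`: distinct points with
positive weights summing to `1`. -/
structure WeightedCode (n N : ℕ) where
  point : Fin N → Metric.sphere (0 : EuclideanSpace ℝ (Fin n)) 1
  point_injective : Function.Injective point
  w : Fin N → ℝ
  w_pos : ∀ i, 0 < w i
  w_sum : ∑ i, w i = 1

/-- The weighted moment `M_ℓ(C, W) = ∑_{i,j} w_i w_j P_ℓ^{(n)}(x_i · x_j)`. -/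
def WeightedCode.moment {n N : ℕ} (hn : 2 ≤ n) (c : WeightedCode n N) (ℓ : ℕ) : ℝ :=
  ∑ i, ∑ j, c.w i * c.w j *
    (gegenbauer n hn ℓ).eval
      (inner ℝ (c.point i : EuclideanSpace ℝ (Fin n)) (c.point j : EuclideanSpace ℝ (Fin n)))

/-- A weighted spherical design of strength `τ`: the first `τ` weighted moments vanish. -/
def WeightedCode.IsDesign {n N : ℕ} (hn : 2 ≤ n) (c : WeightedCode n N) (τ : ℕ) : Prop :=
  ∀ ℓ : ℕ, 1 ≤ ℓ → ℓ ≤ τ → c.moment hn ℓ = 0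

end WeightedDesign

end

/-! By linearity, the identity needs checking only on `P_0 = 1`, where it says that the weights sum
to one, and on `P_ℓ` with `1 ≤ ℓ ≤ τ`, where the right side is zero. Taking `x = x_i` and averaging
over `i` gives the vanishing moments. The converse rests on the reproducing identity `∫ P_ℓ(x·z)
P_ℓ(y·z) dσ(z) = a P_ℓ(x·y)` with `a > 0` (`IsGegenbauer.exists_integral_mul`). For `G(z) = ∑ w_j
P_ℓ(x_j·z)` it yields `∫ G² = a M_ℓ = 0`, so `G = 0` almost everywhere. Integrating `G` against
`P_ℓ(x·z)` then gives `a G(x) = 0` at every `x` (`IsGegenbauer.sum_eq_zero`).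

For the reproducing identity, rotation invariance makes the left side a polynomial `h(x·y)` of
degree at most `ℓ` (`exists_integral_zonal_mul_zonal`). Fubini shows that `h` is orthogonal to lower
degrees, hence a multiple of `P_ℓ`. The passage between `σ` and `μ_n` (`exists_integral_zonal_eq`)
compares moments, which obey the same two-step recurrence. -/

namespace WeightedDesign

open Polynomial MeasureTheory Metric

/-! ### Rotation invariance and zonal integrals on the sphere. -/

section Sphere

variable {E : Type*} [NormedAddCommGroup E] [InnerProductSpace ℝ E]

/-- The action of a linear isometry on the unit sphere. -/
def sphereMap (R : E ≃ₗᵢ[ℝ] E) (z : sphere (0 : E) 1) : sphere (0 : E) 1 :=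
  ⟨R z, by simp⟩

theorem continuous_sphereMap (R : E ≃ₗᵢ[ℝ] E) : Continuous (sphereMap R) :=
  (R.continuous.comp continuous_subtype_val).subtype_mk _

variable [FiniteDimensional ℝ E] [MeasurableSpace E] [BorelSpace E]

/-- The surface measure of the unit sphere. -/
local notation "σ" => Measure.toSphere (volume : Measure E)

theorem integrable_toSphere {f : sphere (0 : E) 1 → ℝ} (hf : Continuous f) : Integrable f σ :=
  hf.integrable_of_hasCompactSupport (HasCompactSupport.of_compactSpace f)

/-- Surface measure is a multiple of the volume of the cone over a set; forming cones commutes with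
`R`, and `R` preserves volume. -/
theorem measurePreserving_sphereMap (R : E ≃ₗᵢ[ℝ] E) : MeasurePreserving (sphereMap R) σ σ := by
  have hm : Measurable (sphereMap R) := (continuous_sphereMap R).measurable
  refine ⟨hm, Measure.ext fun s hs => ?_⟩
  rw [Measure.map_apply hm hs, Measure.toSphere_apply' _ (hm hs), Measure.toSphere_apply' _ hs]
  congr 1
  refine Eq.trans ?_ (R.measurePreserving.measure_preimage_equiv (f := R.toMeasurableEquiv) _)
  congr 1
  ext v
  simp only [Set.mem_smul, Set.mem_image, Set.mem_preimage]
  constructor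
  · rintro ⟨r, hr, _, ⟨z, hz, rfl⟩, rfl⟩
    exact ⟨r, hr, R z, ⟨sphereMap R z, hz, rfl⟩, by simp⟩
  · rintro ⟨r, hr, _, ⟨z, hz, rfl⟩, h⟩
    refine ⟨r, hr, R.symm z, ⟨sphereMap R.symm z, ?_, rfl⟩, ?_⟩
    · have : sphereMap R (sphereMap R.symm z) = z := Subtype.ext (by simp [sphereMap])
      rwa [this]
    · apply R.injective
      rw [map_smul, R.apply_symm_apply]
      exact h

/-- The reflection in the hyperplane orthogonal to `v - w` carries `v` to `w` and preserves `σ`. -/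
theorem integral_inner_eq_of_norm_eq {v w : E} (h : ‖v‖ = ‖w‖) {g : ℝ → ℝ} (hg : Continuous g) :
    ∫ z : sphere (0 : E) 1, g (inner ℝ v (z : E)) ∂σ = ∫ z, g (inner ℝ w (z : E)) ∂σ := by
  set R : E ≃ₗᵢ[ℝ] E := (ℝ ∙ (v - w))ᗮ.reflection
  have hR : R v = w := Submodule.reflection_sub h
  have hc : Continuous fun z : sphere (0 : E) 1 => g (inner ℝ w (z : E)) := by fun_prop
  have hp := measurePreserving_sphereMap R
  rw [← hp.map_eq, integral_map hp.measurable.aemeasurable hc.aestronglyMeasurable, hp.map_eq]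
  refine integral_congr_ae (Filter.Eventually.of_forall fun z => ?_)
  change _ = g (inner ℝ w (R z))
  rw [← hR, R.inner_map_map]

theorem integral_inner_pow {e : E} (he : ‖e‖ = 1) (v : E) (k : ℕ) :
    ∫ z : sphere (0 : E) 1, (inner ℝ v (z : E)) ^ k ∂σ =
      ‖v‖ ^ k * ∫ z, (inner ℝ e (z : E)) ^ k ∂σ := by
  rw [integral_inner_eq_of_norm_eq (w := ‖v‖ • e) (by simp [norm_smul, he])
    (g := fun t => t ^ k) (by fun_prop), ← integral_const_mul]
  refine integral_congr_ae (Filter.Eventually.of_forall fun z => ?_)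
  simp only [real_inner_smul_left, mul_pow]

theorem integral_inner_pow_of_odd (e : E) {k : ℕ} (hk : Odd k) :
    ∫ z : sphere (0 : E) 1, (inner ℝ e (z : E)) ^ k ∂σ = 0 := by
  have h := integral_inner_eq_of_norm_eq (v := e) (w := -e) (by simp)
    (g := fun t => t ^ k) (by fun_prop)
  simp only [inner_neg_left, hk.neg_pow, integral_neg] at h
  linarith

/-- The polynomial `(1 + 2cX + X²)^d`, which for unit vectors `x, y` with `c = ⟪x, y⟫` evaluates at
`s` to `‖x + s y‖ ^ (2 * d)`. -/
noncomputable def normPoly {R : Type*} [CommRing R] (c : R) (d : ℕ) : R[X] := (1 + C (2 * c) * X + X ^ 2) ^ d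

/-- Here `c` is itself a variable. It occurs only in the term `2cs`, so each factor `c` brings a
factor `s`. This controls the degree of zonal integrals. -/
theorem natDegree_coeff_normPoly_le (d b : ℕ) :
    ((normPoly (X : ℝ[X]) d).coeff b).natDegree ≤ b := by
  induction d generalizing b with
  | zero =>
    simp only [normPoly, pow_zero, coeff_one]
    split_ifs <;> simp
  | succ d ih =>
    have h : normPoly (X : ℝ[X]) (d + 1) = normPoly (X : ℝ[X]) d + C (2 * X) * (normPoly (X : ℝ[X]) d * X) +
        normPoly (X : ℝ[X]) d * X ^ 2 := by
      simp only [normPoly]; ring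
    rw [h, coeff_add, coeff_add, coeff_C_mul]
    refine natDegree_add_le_of_degree_le (natDegree_add_le_of_degree_le (ih b) ?_) ?_
    · rcases b with _ | b
      · simp
      · rw [coeff_mul_X]
        have h1 : ((2 : ℝ[X]) * X).natDegree ≤ 1 := by compute_degree
        exact natDegree_mul_le.trans (by have := ih b; omega)
    · rw [coeff_mul_X_pow']
      split_ifs
      · exact (ih _).trans (by omega)
      · simp

theorem eval_coeff_normPoly (c : ℝ) (d b : ℕ) :
    ((normPoly (X : ℝ[X]) d).coeff b).eval c = (normPoly c d).coeff b := by
  have h : (normPoly (X : ℝ[X]) d).map (evalRingHom c) = normPoly c d := by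
    simp [normPoly]
  rw [← h, coeff_map, coe_evalRingHom]

theorem coeff_normPoly (c : ℝ) (d : ℕ) :
    (normPoly c d).coeff 0 = 1 ∧ (normPoly c d).coeff 1 = 2 * d * c ∧
      (normPoly c d).coeff 2 = d + 2 * d * (d - 1) * c ^ 2 := by
  induction d with
  | zero => simp [normPoly, coeff_one]
  | succ d ih =>
    have h : normPoly c (d + 1) = normPoly c d + C (2 * c) * (normPoly c d * X) +
        normPoly c d * X ^ 2 := by
      simp only [normPoly]; ring
    obtain ⟨h0, h1, h2⟩ := ih
    refine ⟨?_, ?_, ?_⟩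
    · rw [h]; simp [h0]
    · rw [h, coeff_add, coeff_add, coeff_C_mul, coeff_mul_X_pow', coeff_mul_X, h0, h1]
      simp; ring
    · rw [h, coeff_add, coeff_add, coeff_C_mul, coeff_mul_X_pow', coeff_mul_X, h1, h2]
      simp [h0]; ring

/-- Compare coefficients of `s ^ b` in `∫ ⟪x + s y, z⟫ ^ k = ‖x + s y‖ ^ k * m`, where `k = a + b`
and `m` is the `k`-th moment. -/
theorem integral_inner_pow_mul_inner_pow {e x y : E} (he : ‖e‖ = 1) (hx : ‖x‖ = 1) (hy : ‖y‖ = 1)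
    (a b : ℕ) :
    (a + b).choose b * ∫ z : sphere (0 : E) 1, (inner ℝ x (z : E)) ^ a * (inner ℝ y (z : E)) ^ b ∂σ =
      (∫ z : sphere (0 : E) 1, (inner ℝ e (z : E)) ^ (a + b) ∂σ) *
        (normPoly (inner ℝ x y) ((a + b) / 2)).coeff b := by
  set k := a + b with hk
  set m := ∫ z : sphere (0 : E) 1, (inner ℝ e (z : E)) ^ k ∂σ with hm
  have key : ∑ j ∈ Finset.range (k + 1), C (k.choose j *
      ∫ z : sphere (0 : E) 1, (inner ℝ x (z : E)) ^ (k - j) * (inner ℝ y (z : E)) ^ j ∂σ) * X ^ j =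
      C m * normPoly (inner ℝ x y) (k / 2) := by
    refine Polynomial.funext fun s => ?_
    have h1 : eval s (C m * normPoly (inner ℝ x y) (k / 2)) = ‖x + s • y‖ ^ k * m := by
      rcases Nat.even_or_odd' k with ⟨d, hd | hd⟩
      · have : k / 2 = d := by omega
        have hn : ‖x + s • y‖ ^ 2 = 1 + 2 * inner ℝ x y * s + s ^ 2 := by
          rw [norm_add_sq_real, real_inner_smul_right, norm_smul, hx, hy]
          simp; ring
        rw [this, hd, pow_mul, hn, mul_comm]
        simp [normPoly]
      -- For odd `k` the rounding in `k / 2` is harmless, because `m = 0`.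
      · rw [hm, integral_inner_pow_of_odd e ⟨d, hd⟩]; simp
    rw [h1, ← integral_inner_pow he, eval_finsetSum]
    simp only [eval_mul, eval_C, eval_pow, eval_X]
    have h2 : ∀ z : sphere (0 : E) 1, (inner ℝ (x + s • y) (z : E)) ^ k =
        ∑ j ∈ Finset.range (k + 1), (k.choose j * s ^ j) *
          ((inner ℝ x (z : E)) ^ (k - j) * (inner ℝ y (z : E)) ^ j) := by
      intro z
      rw [inner_add_left, real_inner_smul_left, add_comm, add_pow]
      refine Finset.sum_congr rfl fun j _ => ?_
      rw [mul_pow]; ring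
    simp_rw [h2]
    rw [integral_finsetSum]
    · refine Finset.sum_congr rfl fun j _ => ?_
      rw [integral_const_mul]; ring
    · intro j _
      exact integrable_toSphere (by fun_prop)
  have := congrArg (fun p => coeff p b) key
  simp only [finsetSum_coeff, coeff_C_mul, coeff_X_pow, mul_ite, mul_one, mul_zero] at this
  rw [Finset.sum_ite_eq, if_pos (by simp; omega)] at this
  rw [← this]
  congr 3
  ext z
  congr 2
  omega

/-- Insert `1 = ∑ ⟪B i, z⟫ ^ 2` for an orthonormal basis `B`, evaluate each mixed moment by the `s ^
2` coefficient of `normPoly`, and use `∑ ⟪B i, e⟫ ^ 2 = 1`. Odd moments vanish. -/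
theorem integral_inner_pow_add_two {e : E} (he : ‖e‖ = 1) (k : ℕ) :
    (k + Module.finrank ℝ E) * ∫ z : sphere (0 : E) 1, (inner ℝ e (z : E)) ^ (k + 2) ∂σ =
      (k + 1) * ∫ z : sphere (0 : E) 1, (inner ℝ e (z : E)) ^ k ∂σ := by
  rcases Nat.even_or_odd' k with ⟨d, hd | hd⟩
  swap
  · rw [integral_inner_pow_of_odd e ⟨d, hd⟩, integral_inner_pow_of_odd e (k := k + 2)
      ⟨d + 1, by omega⟩]
    simp
  set B := stdOrthonormalBasis ℝ E
  have hsq : ∀ v : E, ∑ i, (inner ℝ (B i) v) ^ 2 = ‖v‖ ^ 2 := fun v => by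
    rw [← B.sum_sq_norm_inner_right v]; simp
  have h1 : ∫ z : sphere (0 : E) 1, (inner ℝ e (z : E)) ^ k ∂σ =
      ∑ i, ∫ z : sphere (0 : E) 1, (inner ℝ e (z : E)) ^ k * (inner ℝ (B i) (z : E)) ^ 2 ∂σ := by
    rw [← integral_finsetSum]
    · refine integral_congr_ae (Filter.Eventually.of_forall fun z => ?_)
      simp only
      rw [← Finset.mul_sum, hsq]
      simp
    · intro i _
      exact integrable_toSphere (by fun_prop)
  have h2 : ∀ i, ((k + 2).choose 2 : ℝ) *
      ∫ z : sphere (0 : E) 1, (inner ℝ e (z : E)) ^ k * (inner ℝ (B i) (z : E)) ^ 2 ∂σ =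
      (∫ z : sphere (0 : E) 1, (inner ℝ e (z : E)) ^ (k + 2) ∂σ) *
        ((d + 1) + 2 * (d + 1) * d * (inner ℝ (B i) e) ^ 2) := by
    intro i
    rw [integral_inner_pow_mul_inner_pow he he (by simp), (coeff_normPoly _ _).2.2,
      real_inner_comm, show (k + 2) / 2 = d + 1 by omega]
    push_cast
    ring
  have h3 := Finset.sum_congr rfl fun i (_ : i ∈ Finset.univ) => h2 i
  rw [← Finset.mul_sum, ← h1, ← Finset.mul_sum, Finset.sum_add_distrib, ← Finset.mul_sum, hsq,
    Nat.cast_choose_two] at h3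
  simp only [Finset.sum_const, Finset.card_univ, Fintype.card_fin, nsmul_eq_mul, he] at h3
  have hkd : (k : ℝ) = 2 * d := by exact_mod_cast hd
  have hd0 : (d + 1 : ℝ) ≠ 0 := by positivity
  apply mul_left_cancel₀ hd0
  push_cast at h3
  rw [hkd] at h3 ⊢
  linear_combination -h3

/-- Integrals of products of two zonal polynomials are again zonal polynomials. -/
theorem exists_integral_zonal_mul_zonal {e : E} (he : ‖e‖ = 1) (f g : ℝ[X]) :
    ∃ h : ℝ[X], h.natDegree ≤ g.natDegree ∧ ∀ x y : E, ‖x‖ = 1 → ‖y‖ = 1 →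
      ∫ z : sphere (0 : E) 1, f.eval (inner ℝ x (z : E)) * g.eval (inner ℝ y (z : E)) ∂σ =
        h.eval (inner ℝ x y) := by
  -- The mixed moment of exponents `a`, `b`, with `⟪x, y⟫` replaced by a variable.
  let H : ℕ → ℕ → ℝ[X] := fun a b =>
    C (((a + b).choose b : ℝ)⁻¹ * ∫ z : sphere (0 : E) 1, (inner ℝ e (z : E)) ^ (a + b) ∂σ) *
      (normPoly (X : ℝ[X]) ((a + b) / 2)).coeff b
  refine ⟨∑ a ∈ f.support, ∑ b ∈ g.support, C (f.coeff a * g.coeff b) * H a b, ?_, ?_⟩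
  · refine natDegree_sum_le_of_forall_le _ _ fun a _ =>
      natDegree_sum_le_of_forall_le _ _ fun b hb => ?_
    refine (natDegree_C_mul_le _ _).trans ((natDegree_C_mul_le _ _).trans ?_)
    -- Only the exponent `b` coming from `g` enters the bound; the degree of `f` is irrelevant.
    exact (natDegree_coeff_normPoly_le _ _).trans (le_natDegree_of_mem_supp b hb)
  · intro x y hx hy
    have h1 : ∀ z : sphere (0 : E) 1,
        f.eval (inner ℝ x (z : E)) * g.eval (inner ℝ y (z : E)) =
        ∑ a ∈ f.support, ∑ b ∈ g.support, f.coeff a * g.coeff b *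
          ((inner ℝ x (z : E)) ^ a * (inner ℝ y (z : E)) ^ b) := by
      intro z
      rw [eval_eq_sum, eval_eq_sum, Polynomial.sum, Polynomial.sum, Finset.sum_mul_sum]
      exact Finset.sum_congr rfl fun a _ => Finset.sum_congr rfl fun b _ => by ring
    simp_rw [h1]
    rw [integral_finsetSum _ fun a _ => integrable_toSphere (by fun_prop), eval_finsetSum]
    refine Finset.sum_congr rfl fun a _ => ?_
    rw [integral_finsetSum _ fun a _ => integrable_toSphere (by fun_prop), eval_finsetSum]
    refine Finset.sum_congr rfl fun b _ => ?_
    have hc : ((a + b).choose b : ℝ) ≠ 0 := by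
      exact_mod_cast (Nat.choose_pos (Nat.le_add_left b a)).ne'
    rw [integral_const_mul, eval_mul, eval_mul, eval_C, eval_C, eval_coeff_normPoly, mul_assoc _ _
      (coeff _ b), ← integral_inner_pow_mul_inner_pow he hx hy, inv_mul_cancel_left₀ hc]

end Sphere

/-! ### Moments of `μ_n`. -/

/-- Integrate the derivative of `t ^ (k + 1) * (1 - t ^ 2) ^ ((n - 1) / 2)`; the boundary terms
vanish since the last exponent is positive. -/
theorem ip_X_pow_add_two {n : ℕ} (hn : 2 ≤ n) (k : ℕ) :
    (k + n) * ip n (X ^ (k + 2)) 1 = (k + 1) * ip n (X ^ k) 1 := by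
  have h2 : (2 : ℝ) ≤ n := by exact_mod_cast hn
  set r : ℝ := ((n : ℝ) - 1) / 2 with hr
  have hint := ((intervalIntegrable_ip hn (X ^ k) 1).const_mul (k + 1 : ℝ)).sub
    ((intervalIntegrable_ip hn (X ^ (k + 2)) 1).const_mul (k + n : ℝ))
  have hF := intervalIntegral.integral_eq_sub_of_hasDerivAt_of_le (a := -1) (b := 1)
    (f := fun t : ℝ => gammaConst n * (t ^ (k + 1) * (1 - t ^ 2) ^ r)) (by norm_num) ?_ ?_ hint
  · rw [intervalIntegral.integral_sub ((intervalIntegrable_ip hn (X ^ k) 1).const_mul _)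
      ((intervalIntegrable_ip hn (X ^ (k + 2)) 1).const_mul _),
      intervalIntegral.integral_const_mul, intervalIntegral.integral_const_mul] at hF
    have hr0 : r ≠ 0 := by rw [hr]; linarith
    norm_num [Real.zero_rpow hr0] at hF
    unfold ip
    norm_num
    linarith
  · refine Continuous.continuousOn ?_
    have : Continuous fun t : ℝ => (1 - t ^ 2) ^ r :=
      Continuous.rpow_const (by fun_prop) fun _ => Or.inr (by rw [hr]; linarith)
    fun_prop
  · intro t ht
    have h0 : 0 < 1 - t ^ 2 := by nlinarith [ht.1, ht.2]
    have hb : HasDerivAt (fun t : ℝ => 1 - t ^ 2) (-(2 * t)) t := by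
      simpa using (hasDerivAt_pow 2 t).const_sub 1
    have hd := (((hasDerivAt_pow (k + 1) t).mul
      (hb.rpow_const (p := r) (Or.inl h0.ne'))).const_mul (gammaConst n))
    refine hd.congr_deriv ?_
    have he : (1 - t ^ 2) ^ r = (1 - t ^ 2) * (1 - t ^ 2) ^ (((n : ℝ) - 3) / 2) := by
      rw [← Real.rpow_one_add' h0.le (by linarith)]
      congr 1
      rw [hr]; ring
    have he' : r - 1 = ((n : ℝ) - 3) / 2 := by rw [hr]; ring
    simp only [eval_pow, eval_X, eval_one, weight, he, he']
    rw [hr]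
    push_cast
    ring

theorem ip_X_one {n : ℕ} : ip n X 1 = 0 := by
  have h : ip n X 1 = -ip n X 1 := by
    unfold ip
    rw [← intervalIntegral.integral_neg]
    have := intervalIntegral.integral_comp_neg (a := -1) (b := 1)
      (fun t : ℝ => (X : ℝ[X]).eval t * (1 : ℝ[X]).eval t * weight n t)
    rw [neg_neg] at this
    rw [← this]
    refine intervalIntegral.integral_congr fun t _ => ?_
    simp [weight]
  linarith

/-! ### Funk–Hecke identity for Gegenbauer kernels. -/

section FunkHecke

variable {E : Type*} [NormedAddCommGroup E] [InnerProductSpace ℝ E] [FiniteDimensional ℝ E]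
  [MeasurableSpace E] [BorelSpace E]

local notation "σ" => Measure.toSphere (volume : Measure E)

theorem ip_eq_ip_mul_one {n : ℕ} (p q : ℝ[X]) : ip n p q = ip n (p * q) 1 := by
  simp [ip]

/-- Up to a constant, `μ_n` is the distribution of a coordinate of a point of the unit sphere. -/
theorem exists_integral_zonal_eq {n : ℕ} (hn : 2 ≤ n) (hE : Module.finrank ℝ E = n) :
    ∃ κ : ℝ, 0 < κ ∧ ∀ e : E, ‖e‖ = 1 → ∀ p : ℝ[X],
      ∫ z : sphere (0 : E) 1, p.eval (inner ℝ e (z : E)) ∂σ = κ * ip n p 1 := by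
  have : Nontrivial E := Module.nontrivial_of_finrank_pos (R := ℝ) (by omega)
  have h11 : 0 < ip n 1 1 := ip_self_pos hn one_ne_zero
  have hσ : 0 < (σ).real Set.univ := by
    rw [Measure.real, ENNReal.toReal_pos_iff]
    exact ⟨Measure.measure_univ_pos.2 (Measure.toSphere_ne_zero _), measure_lt_top _ _⟩
  -- The constant is forced by `p = 1`.
  refine ⟨(σ).real Set.univ / ip n 1 1, div_pos hσ h11, fun e he p => ?_⟩
  set κ := (σ).real Set.univ / ip n 1 1
  have hpow : ∀ k : ℕ, ∫ z : sphere (0 : E) 1, (inner ℝ e (z : E)) ^ k ∂σ =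
      κ * ip n (X ^ k) 1 := by
    intro k
    induction k using Nat.twoStepInduction with
    | zero => simp [κ, h11.ne']
    | one => rw [integral_inner_pow_of_odd e odd_one, pow_one, ip_X_one, mul_zero]
    | more k ih _ =>
      have h1 := integral_inner_pow_add_two he k
      have h2 := ip_X_pow_add_two hn k
      have h0 : (k + n : ℝ) ≠ 0 := by positivity
      rw [hE, ih] at h1
      apply mul_left_cancel₀ h0
      linear_combination h1 - κ * h2
  induction p using Polynomial.induction_on' with
  | add p q hp hq =>
    simp only [eval_add]
    rw [integral_add (integrable_toSphere (by fun_prop)) (integrable_toSphere (by fun_prop)),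
      hp, hq, ← ipForm_apply n hn (p + q), map_add, LinearMap.add_apply, mul_add]
    rfl
  | monomial k a =>
    simp only [eval_monomial]
    rw [integral_const_mul, hpow, ← smul_X_eq_monomial, ← ipForm_apply n hn (a • X ^ k), map_smul,
      LinearMap.smul_apply, ipForm_apply, smul_eq_mul]
    ring

/-- A polynomial orthogonal to everything of degree less than `i`, and itself of degree at most
`i`, is a multiple of the Gegenbauer polynomial. -/
theorem IsGegenbauer.eq_smul {n i : ℕ} (hn : 2 ≤ n) {p h : ℝ[X]} (hp : IsGegenbauer n i p)
    (hdeg : h.natDegree ≤ i) (horth : ∀ q : ℝ[X], q.degree < (i : WithBot ℕ) → ip n h q = 0) :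
    h = h.eval 1 • p := by
  have hpn : p.natDegree = i := natDegree_eq_of_degree_eq_some hp.degree_eq
  have hp0 : p.coeff i ≠ 0 := by
    rw [← hpn, coeff_natDegree]
    exact leadingCoeff_ne_zero.2 fun h0 => by simpa [h0] using hp.degree_eq
  set a := h.coeff i / p.coeff i with ha
  have hd : (h - a • p).degree < (i : WithBot ℕ) := by
    rw [degree_lt_iff_coeff_zero]
    intro m hm
    rcases hm.eq_or_lt with rfl | hm
    · simp [ha, hp0]
    · simp [coeff_eq_zero_of_natDegree_lt (hdeg.trans_lt hm),
        coeff_eq_zero_of_natDegree_lt (hpn.trans_lt hm)]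
  -- Cancelling the top coefficient leaves degree below `i`, so the difference is orthogonal to
  -- itself.
  have h0 : ip n (h - a • p) (h - a • p) = 0 := by
    have e : ipForm n hn (h - a • p) (h - a • p) =
        ip n h (h - a • p) - a * ip n p (h - a • p) := by
      rw [map_sub (ipForm n hn) h, map_smul (ipForm n hn) a p]
      rfl
    rw [← ipForm_apply n hn, e, horth _ hd, hp.orthogonal _ hd]
    simp
  have h1 : h = a • p := by
    by_contra hne
    exact (ip_self_pos hn (sub_ne_zero.2 hne)).ne' h0
  have h2 : h.eval 1 = a := by
    rw [h1, eval_smul, hp.eval_one, smul_eq_mul, mul_one]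
  rwa [h2]

/-- The Gegenbauer kernel reproduces itself up to a positive constant. -/
theorem IsGegenbauer.exists_integral_mul {n i : ℕ} (hn : 2 ≤ n) (hE : Module.finrank ℝ E = n)
    {p : ℝ[X]} (hp : IsGegenbauer n i p) :
    ∃ a : ℝ, 0 < a ∧ ∀ x y : E, ‖x‖ = 1 → ‖y‖ = 1 →
      ∫ z : sphere (0 : E) 1, p.eval (inner ℝ x (z : E)) * p.eval (inner ℝ y (z : E)) ∂σ =
        a * p.eval (inner ℝ x y) := by
  have : Nontrivial E := Module.nontrivial_of_finrank_pos (R := ℝ) (by omega)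
  obtain ⟨e, he⟩ := exists_norm_eq E zero_le_one
  obtain ⟨κ, hκ, hκp⟩ := exists_integral_zonal_eq hn hE
  have hpn : p.natDegree = i := natDegree_eq_of_degree_eq_some hp.degree_eq
  have hp0 : p ≠ 0 := fun h0 => by simpa [h0] using hp.degree_eq
  obtain ⟨h, hdeg, hh⟩ := exists_integral_zonal_mul_zonal he p p
  have horth : ∀ q : ℝ[X], q.degree < (i : WithBot ℕ) → ip n h q = 0 := by
    intro q hq
    obtain ⟨r, hrdeg, hr⟩ := exists_integral_zonal_mul_zonal he p q
    have hri : r.degree < (i : WithBot ℕ) := by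
      -- For `i = 0` the bound on `natDegree` is too weak: `r` must be zero, which follows from `q =
      -- 0` by evaluating the integral.
      rcases eq_or_ne i 0 with rfl | hi
      · have : q = 0 := by simpa using hq
        subst this
        have h0 : r = C (r.coeff 0) := eq_C_of_natDegree_le_zero (by simpa using hrdeg)
        have h1 := hr e e he he
        rw [h0] at h1 ⊢
        simp only [eval_zero, mul_zero, integral_zero, eval_C] at h1
        simp [← h1]
      · have : q.natDegree < i := by
          rcases eq_or_ne q 0 with rfl | hq0
          · simpa using Nat.pos_of_ne_zero hi
          · exact (natDegree_lt_iff_degree_lt hq0).2 hq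
        exact degree_le_natDegree.trans_lt (by exact_mod_cast hrdeg.trans_lt this)
    -- Both sides are the double integral of `p(e·z) p(z·x) q(e·x)`, taken in the two orders.
    have hswap : κ * ip n h q = κ * ip n p r := by
      rw [ip_eq_ip_mul_one h, ip_eq_ip_mul_one p, ← hκp e he, ← hκp e he]
      simp only [eval_mul]
      have h1 : ∀ x : sphere (0 : E) 1, h.eval (inner ℝ e (x : E)) * q.eval (inner ℝ e (x : E)) =
          ∫ z : sphere (0 : E) 1, p.eval (inner ℝ e (z : E)) *
            (p.eval (inner ℝ (z : E) (x : E)) * q.eval (inner ℝ e (x : E))) ∂σ := by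
        intro x
        rw [← hh e x he (by simp), ← integral_mul_const]
        refine integral_congr_ae (Filter.Eventually.of_forall fun z => ?_)
        simp only [real_inner_comm (z : E) (x : E)]
        ring
      have h2 : ∀ z : sphere (0 : E) 1, p.eval (inner ℝ e (z : E)) * r.eval (inner ℝ e (z : E)) =
          ∫ x : sphere (0 : E) 1, p.eval (inner ℝ e (z : E)) *
            (p.eval (inner ℝ (z : E) (x : E)) * q.eval (inner ℝ e (x : E))) ∂σ := by
        intro z
        rw [integral_const_mul, hr z e (by simp) he, real_inner_comm]
      simp_rw [h1, h2]
      refine integral_integral_swap ?_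
      refine Continuous.integrable_of_hasCompactSupport ?_ (HasCompactSupport.of_compactSpace _)
      unfold Function.uncurry
      fun_prop
    rw [hp.orthogonal r hri, mul_zero] at hswap
    exact (mul_eq_zero.1 hswap).resolve_left hκ.ne'
  have hhp := hp.eq_smul hn (hdeg.trans hpn.le) horth
  refine ⟨h.eval 1, ?_, fun x y hx hy => ?_⟩
  -- Setting `x = y = e` identifies the constant as `κ` times the squared norm of `p`, hence
  -- positive.
  · have h1 := hh e e he he
    rw [real_inner_self_eq_norm_sq, he, one_pow] at h1
    simp_rw [← eval_mul] at h1
    rw [← h1, hκp e he, ← ip_eq_ip_mul_one]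
    exact mul_pos hκ (ip_self_pos hn hp0)
  · rw [hh x y hx hy]
    conv_lhs => rw [hhp]
    simp

/-- If a weighted energy of the Gegenbauer kernel vanishes, so does the weighted potential. -/
theorem IsGegenbauer.sum_eq_zero {n i : ℕ} (hn : 2 ≤ n) (hE : Module.finrank ℝ E = n) {p : ℝ[X]}
    (hp : IsGegenbauer n i p) {ι : Type*} [Fintype ι] (v : ι → sphere (0 : E) 1) (w : ι → ℝ)
    (h : ∑ i, ∑ j, w i * w j * p.eval (inner ℝ (v i : E) (v j : E)) = 0) {x : E} (hx : ‖x‖ = 1) :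
    ∑ j, w j * p.eval (inner ℝ x (v j : E)) = 0 := by
  obtain ⟨a, ha, hap⟩ := hp.exists_integral_mul hn hE
  let G : sphere (0 : E) 1 → ℝ := fun z => ∑ j, w j * p.eval (inner ℝ (v j : E) (z : E))
  have hG : Continuous G := by fun_prop
  have hGx : ∀ y : E, ‖y‖ = 1 → ∫ z : sphere (0 : E) 1, p.eval (inner ℝ y (z : E)) * G z ∂σ =
      a * ∑ j, w j * p.eval (inner ℝ y (v j : E)) := by
    intro y hy
    simp only [G, Finset.mul_sum]
    rw [integral_finsetSum _ fun j _ => integrable_toSphere (by fun_prop)]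
    refine Finset.sum_congr rfl fun j _ => ?_
    rw [mul_left_comm, ← hap y (v j) hy (by simp), ← integral_const_mul]
    exact integral_congr_ae (Filter.Eventually.of_forall fun z => by ring)
  have hGG : ∫ z, G z ^ 2 ∂σ = 0 := by
    have h1 : ∀ z, G z ^ 2 = ∑ j, w j * (p.eval (inner ℝ (v j : E) (z : E)) * G z) := by
      intro z
      rw [sq]
      conv_lhs => rw [show G z * G z = (∑ j, w j * p.eval (inner ℝ (v j : E) (z : E))) * G z from rfl]
      rw [Finset.sum_mul]
      exact Finset.sum_congr rfl fun j _ => by ring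
    simp_rw [h1]
    rw [integral_finsetSum _ fun j _ => integrable_toSphere (by fun_prop)]
    simp_rw [integral_const_mul, hGx _ (norm_eq_of_mem_sphere (v _))]
    rw [← mul_zero a, ← h, Finset.mul_sum]
    refine Finset.sum_congr rfl fun j _ => ?_
    rw [mul_left_comm, Finset.mul_sum]
    simp_rw [mul_assoc]
  have hG0 : ∀ᵐ z ∂σ, G z = 0 := by
    have := (integral_eq_zero_iff_of_nonneg (fun z => sq_nonneg (G z))
      (integrable_toSphere (by fun_prop))).1 hGG
    filter_upwards [this] with z hz
    simpa using hz
  -- The reproducing identity turns almost-everywhere vanishing into vanishing at the given point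
  -- `x`.
  have h0 : ∫ z : sphere (0 : E) 1, p.eval (inner ℝ x (z : E)) * G z ∂σ = 0 := by
    rw [← integral_zero (sphere (0 : E) 1) ℝ (μ := σ)]
    refine integral_congr_ae ?_
    filter_upwards [hG0] with z hz
    rw [hz, mul_zero]
  rw [hGx x hx] at h0
  exact (mul_eq_zero.1 h0).resolve_left ha.ne'

end FunkHecke

/-! ### Gegenbauer expansions and the equivalence. -/

theorem gegenbauerCoeff_gegenbauer (n : ℕ) (hn : 2 ≤ n) (k ℓ : ℕ) :
    gegenbauerCoeff n hn (gegenbauer n hn k) ℓ = if k = ℓ then 1 else 0 := by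
  have h : gegenbauer n hn k = gegenbauerBasis n hn k :=
    ((gegenbauerSequence n hn).basis_eq_self _ k).symm
  rw [gegenbauerCoeff, h, Module.Basis.repr_self, Finsupp.single_apply]

theorem gegenbauer_zero (n : ℕ) (hn : 2 ≤ n) : gegenbauer n hn 0 = 1 := by
  have hp := gegenbauer_spec n hn 0
  have h := eq_C_of_degree_eq_zero hp.degree_eq
  have h1 := hp.eval_one
  rw [h, eval_C] at h1
  rw [h, h1, C_1]

theorem mem_span_gegenbauer {n : ℕ} (hn : 2 ≤ n) {τ : ℕ} {f : ℝ[X]} (hf : f.natDegree ≤ τ) :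
    f ∈ Submodule.span ℝ (gegenbauer n hn '' Set.Iic τ) := by
  have h := (gegenbauerSequence n hn).span_degreeLE (m := τ) fun i _ =>
    isUnit_iff_ne_zero.2 (leadingCoeff_ne_zero.2 ((gegenbauerSequence n hn).ne_zero i))
  change f ∈ Submodule.span ℝ (gegenbauerSequence n hn '' Set.Iic τ)
  rw [h, mem_degreeLE]
  exact natDegree_le_iff_degree_le.1 hf

end WeightedDesign

open WeightedDesign in
theorem theorem5p4 (n N τ : ℕ) (hn : 2 ≤ n) (c : WeightedDesign.WeightedCode n N) :
    c.IsDesign hn τ ↔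
      ∀ x : Metric.sphere (0 : EuclideanSpace ℝ (Fin n)) 1,
        ∀ f : Polynomial ℝ, f.natDegree ≤ τ →
          ∑ j, c.w j * f.eval (inner ℝ (x : EuclideanSpace ℝ (Fin n))
            (c.point j : EuclideanSpace ℝ (Fin n))) =
            WeightedDesign.gegenbauerCoeff n hn f 0 := by
  constructor
  · intro hc x f hf
    have hspan := mem_span_gegenbauer hn hf
    clear hf
    induction hspan using Submodule.span_induction with
    | mem f hmem =>
      obtain ⟨ℓ, hℓ, rfl⟩ := hmem
      rw [gegenbauerCoeff_gegenbauer]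
      rcases eq_or_ne ℓ 0 with rfl | h0
      · simp [gegenbauer_zero, c.w_sum]
      · rw [if_neg h0]
        exact (gegenbauer_spec n hn ℓ).sum_eq_zero hn finrank_euclideanSpace_fin c.point c.w
          (hc ℓ (Nat.one_le_iff_ne_zero.2 h0) hℓ) (norm_eq_of_mem_sphere x)
    | zero => simp [gegenbauerCoeff]
    | add f g _ _ ihf ihg =>
      simp only [Polynomial.eval_add, mul_add, Finset.sum_add_distrib, ihf, ihg, gegenbauerCoeff,
        map_add, Finsupp.add_apply]
    | smul a f _ ihf =>
      simp only [Polynomial.eval_smul, smul_eq_mul, mul_left_comm _ a, ← Finset.mul_sum, ihf,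
        gegenbauerCoeff, map_smul, Finsupp.smul_apply]
  · intro h ℓ h1 hℓ
    have hdeg : (gegenbauer n hn ℓ).natDegree = ℓ :=
      Polynomial.natDegree_eq_of_degree_eq_some (gegenbauer_spec n hn ℓ).degree_eq
    have h0 : ∀ i, ∑ j, c.w i * c.w j * (gegenbauer n hn ℓ).eval
        (inner ℝ (c.point i : EuclideanSpace ℝ (Fin n)) (c.point j)) = 0 := by
      intro i
      -- Testing at a code point makes every row of the double sum vanish separately.
      have := h (c.point i) _ (hdeg.trans_le hℓ)
      rw [gegenbauerCoeff_gegenbauer, if_neg (by omega)] at this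
      simp_rw [mul_assoc, ← Finset.mul_sum, this, mul_zero]
    exact Finset.sum_eq_zero fun i _ => h0 i
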